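/- Let $X$ be a Polish space with Borel $\sigma$-field $\mathcal B$, and let $\mathcal B_b\subseteq\mathcal B$ be a family of Borel sets, called bounded sets, that is closed under Borel subsets and under binary unions. Assume that $\mathcal B_b$ properly localizes $X$, that is: (a) for each $B\in\mathcal B_b$ there is an open set $U\in\mathcal B_b$ with $\overline B\subseteq U$; (b) there is a countable subfamily $\mathcal C_b\subseteq\mathcal B_b$ which covers $X$ and is such that every $B\in\mathcal B_b$ is contained in some $C\in\mathcal C_b$. Let $\mathcal M(X)$ be the space of all Borel measures $\mu$ on $X$ with $\mu(B)<\infty$ for all $B\in\mathcal B_b$, and let $CB_b^+(X)$ be the set of all nonnegative bounded continuous functions $f:X\to\mathbb R$ whose support $\overline{\{f\neq 0\}}$ belongs to $\mathcal B_b$. Equip $\mathcal M(X)$ with the vague topology, the smallest topology under which the maps $\mu\mapsto\mu(f)=\int f\,d\mu$ are continuous for all $f\in CB_b^+(X)$. Then $\mathcal M(X)$ is metrizable, and it is a Polish space, i.e. separable and metrizable by a complete metric. -/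

import Mathlib

open MeasureTheory
open scoped BoundedContinuousFunction

namespace VagueTopology

variable {X : Type*}

/-- A (Borel) boundedness: a family of measurable sets closed under measurable subsets and under
binary unions. -/
structure IsBoundedness [MeasurableSpace X] (Bb : Set (Set X)) : Prop where
  measurableSet_of_mem : ∀ B ∈ Bb, MeasurableSet B
  subset_mem : ∀ A B : Set X, MeasurableSet A → A ⊆ B → B ∈ Bb → A ∈ Bb
  union_mem : ∀ A B : Set X, A ∈ Bb → B ∈ Bb → A ∪ B ∈ Bb

/-- A basis of `Bb`: a subfamily such that every member of `Bb` is contained in one of its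
members. -/
def IsBasis (Bb Cb : Set (Set X)) : Prop :=
  Cb ⊆ Bb ∧ ∀ B ∈ Bb, ∃ C ∈ Cb, B ⊆ C

/-- The family `Bb` is proper: the closure of each member is contained in an open member. -/
def IsProper [TopologicalSpace X] (Bb : Set (Set X)) : Prop :=
  ∀ B ∈ Bb, ∃ U ∈ Bb, IsOpen U ∧ closure B ⊆ U

/-- `Bb` properly localizes `X`: it is a proper boundedness with a countable basis which
covers `X`. -/
structure ProperlyLocalizes [TopologicalSpace X] [MeasurableSpace X] (Bb : Set (Set X)) :
    Prop where
  isBoundedness : IsBoundedness Bb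
  isProper : IsProper Bb
  exists_countable_basis : ∃ Cb : Set (Set X), Cb.Countable ∧ IsBasis Bb Cb ∧ ⋃₀ Cb = Set.univ

/-- The space of measures on `X` that are finite on every set of the family `Bb`. -/
structure BoundedlyFiniteMeasure [MeasurableSpace X] (Bb : Set (Set X)) where
  /-- the underlying measure -/
  toMeasure : Measure X
  finite_of_mem : ∀ B ∈ Bb, toMeasure B < ⊤

/-- The nonnegative bounded continuous real functions on `X` whose support (the closure of the set
where the function does not vanish) belongs to `Bb`. -/
def CBbPlus [TopologicalSpace X] (Bb : Set (Set X)) : Set (X →ᵇ ℝ) :=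
  {f | (∀ x, 0 ≤ f x) ∧ tsupport f ∈ Bb}

/-- The integrals that define the vague topology converge. -/
theorem integrable_of_mem_CBbPlus [TopologicalSpace X] [MeasurableSpace X]
    [OpensMeasurableSpace X] {Bb : Set (Set X)} (μ : BoundedlyFiniteMeasure Bb) {f : X →ᵇ ℝ}
    (hf : f ∈ CBbPlus Bb) : Integrable f μ.toMeasure := by
  have h : IntegrableOn f (tsupport f) μ.toMeasure :=
    Measure.integrableOn_of_bounded (μ.finite_of_mem _ hf.2).ne
      f.continuous.measurable.aestronglyMeasurable
      (Filter.Eventually.of_forall fun x => f.norm_coe_le_norm x)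
  exact (integrableOn_iff_integrable_of_support_subset (subset_tsupport f)).1 h

/-- The vague topology: the smallest topology for which `μ ↦ ∫ f dμ` is continuous for every
`f ∈ CBbPlus Bb`. -/
noncomputable instance vagueTopology [TopologicalSpace X] [MeasurableSpace X] (Bb : Set (Set X)) :
    TopologicalSpace (BoundedlyFiniteMeasure Bb) :=
  ⨅ f ∈ CBbPlus Bb, TopologicalSpace.induced
    (fun μ : BoundedlyFiniteMeasure Bb => ∫ x, f x ∂μ.toMeasure) inferInstance

end VagueTopology

namespace VagueTopology

open Filter Set TopologicalSpace Topology
open scoped NNReal ENNReal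

/-! Exhaust `X` by bounded open sets `U n` with `closure (U n) ⊆ U (n + 1)` and choose Urysohn
functions `φ n`, equal to 1 on `closure (U n)` and to 0 off `U (n + 1)`. The map `μ ↦ (φ n • μ)`
into sequences of finite measures with the weak topology is an embedding: a test function supported
in `U n` does not see the factor `φ n`, and `φ n * f` has bounded support for every bounded
continuous `f`. Its range consists of the sequences with `φ n • ν (n + 1) = ν n`, because these
glue; it is closed since multiplication by `φ n` is weakly continuous (`isClosedEmbedding_cutoff`).

It remains to see that finite measures on a Polish space form a Polish space
(`polishSpace_finiteMeasure`). Embed the space as a `Gδ` set `G` in the Hilbert cube `K`. Pushing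
forward identifies its finite measures with those on `K` that do not charge `Gᶜ`, a `Gδ` condition
by semicontinuity, and the compact case is settled by integrals against a dense sequence in `C(K,
ℝ)`. -/

/-! ### Polish subspaces and `Gδ` sets. -/

/-- An embedding into a Polish space with `Gδ` range has a Polish source. -/
theorem polishSpace_of_isEmbedding_of_isGδ {E F : Type*} [TopologicalSpace E]
    [TopologicalSpace F] [PolishSpace F] {f : E → F} (hf : IsEmbedding f)
    (hG : IsGδ (range f)) : PolishSpace E := by
  obtain ⟨V, hVo, hV⟩ := hG.eq_iInter_nat
  have hmem : ∀ x n, f x ∈ V n := fun x n ↦ by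
    have : f x ∈ ⋂ n, V n := hV ▸ mem_range_self x
    exact mem_iInter.1 this n
  have hP : ∀ n, PolishSpace (V n) := fun n ↦ (hVo n).polishSpace
  -- The diagonal map: its range is the closed set of constant sequences, as a value common to all
  -- `V n` lies in `range f`.
  let φ : E → ∀ n, V n := fun x n ↦ ⟨f x, hmem x n⟩
  have hφ : Continuous φ := continuous_pi fun n ↦ hf.continuous.subtype_mk _
  have hemb : IsEmbedding φ :=
    IsEmbedding.of_comp hφ (g := fun v : ∀ n, V n ↦ (v 0 : F)) (by fun_prop) hf
  have hcl : IsClosed (range φ) := by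
    have : range φ = {v | ∀ n, (v n : F) = v 0} := by
      ext v
      constructor
      · rintro ⟨x, rfl⟩ n
        rfl
      · intro h
        have hv : (v 0 : F) ∈ range f := by
          rw [hV]
          exact mem_iInter.2 fun n ↦ h n ▸ (v n).2
        obtain ⟨x, hx⟩ := hv
        exact ⟨x, funext fun n ↦ Subtype.ext (hx.trans (h n).symm)⟩
    rw [this, ofPred_forall]
    exact isClosed_iInter fun n ↦ isClosed_eq (by fun_prop) (by fun_prop)
  exact IsClosedEmbedding.polishSpace ⟨hemb, hcl⟩

/-- A completely metrizable space is a `Gδ` in every metrizable space containing it. -/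
theorem isGδ_range_of_isEmbedding {E F : Type*} [TopologicalSpace E]
    [IsCompletelyMetrizableSpace E] [TopologicalSpace F] [MetrizableSpace F] {f : E → F}
    (hf : IsEmbedding f) : IsGδ (range f) := by
  let := upgradeIsCompletelyMetrizable E
  let := metrizableSpaceMetric F
  -- Points with a neighbourhood whose preimage is small. At a point of the closure lying in all `V
  -- n`, the preimages of neighbourhoods form a Cauchy filter.
  let V : ℕ → Set F := fun n ↦
    ⋃₀ {W | IsOpen W ∧ ∀ a b, f a ∈ W → f b ∈ W → dist a b < 1 / ((n : ℝ) + 1)}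
  have hV : ∀ n, IsOpen (V n) := fun n ↦ isOpen_sUnion fun W hW ↦ hW.1
  have key : range f = closure (range f) ∩ ⋂ n, V n := by
    apply Subset.antisymm
    · rintro _ ⟨x, rfl⟩
      refine ⟨subset_closure (mem_range_self x), mem_iInter.2 fun n ↦ ?_⟩
      have hn : (0 : ℝ) < 1 / ((n : ℝ) + 1) := by positivity
      obtain ⟨W, hWo, hW⟩ := hf.isOpen_iff.1
        (Metric.isOpen_ball (x := x) (ε := 1 / ((n : ℝ) + 1) / 2))
      have hball : ∀ a, f a ∈ W → dist a x < 1 / ((n : ℝ) + 1) / 2 := fun a ha ↦ by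
        have : a ∈ f ⁻¹' W := ha
        rwa [hW] at this
      refine ⟨W, ⟨hWo, fun a b ha hb ↦ ?_⟩, ?_⟩
      · have h1 := hball a ha
        have h2 := hball b hb
        have h3 := dist_triangle_right a b x
        linarith
      · change x ∈ f ⁻¹' W
        rw [hW]
        exact Metric.mem_ball_self (by positivity)
    · rintro y ⟨hy, hyV⟩
      have hne : (comap f (𝓝 y)).NeBot := by
        refine comap_neBot fun t ht ↦ ?_
        obtain ⟨_, hzt, x, rfl⟩ := mem_closure_iff_nhds.1 hy t ht
        exact ⟨x, hzt⟩
      have hC : Cauchy (comap f (𝓝 y)) := by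
        refine Metric.cauchy_iff.2 ⟨hne, fun ε hε ↦ ?_⟩
        obtain ⟨n, hn⟩ := exists_nat_one_div_lt hε
        obtain ⟨W, ⟨hWo, hW⟩, hyW⟩ := mem_iInter.1 hyV n
        exact ⟨f ⁻¹' W, preimage_mem_comap (hWo.mem_nhds hyW),
          fun a ha b hb ↦ (hW a b ha hb).trans hn⟩
      obtain ⟨x, hx⟩ := CompleteSpace.complete hC
      have h1 : Tendsto f (comap f (𝓝 y)) (𝓝 (f x)) := (hf.continuous.tendsto x).mono_left hx
      exact ⟨x, tendsto_nhds_unique h1 tendsto_comap⟩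
  rw [key]
  exact isClosed_closure.isGδ.inter (IsGδ.iInter_of_isOpen hV)

/-! ### Finite measures with the weak topology. -/

/-- The finite measures on a compact metrizable space form a Polish space. -/
theorem polishSpace_finiteMeasure_of_compactSpace (K : Type*) [TopologicalSpace K]
    [CompactSpace K] [MetrizableSpace K] [MeasurableSpace K] [BorelSpace K] :
    PolishSpace (FiniteMeasure K) := by
  let := metrizableSpaceMetric K
  let Φ : FiniteMeasure K → ℝ≥0 × (ℕ → ℝ) :=
    fun ν ↦ (ν.mass, fun n ↦ ∫ x, denseSeq C(K, ℝ) n x ∂(ν : Measure K))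
  have hΦ : Continuous Φ := by
    refine FiniteMeasure.continuous_mass.prodMk (continuous_pi fun n ↦ ?_)
    exact FiniteMeasure.continuous_integral_continuousMap _
  have hint : ∀ (ν : FiniteMeasure K) (f : C(K, ℝ)), Integrable f (ν : Measure K) := fun ν f ↦
    (BoundedContinuousFunction.mkOfCompact f).integrable _
  have hinj : Function.Injective Φ := by
    intro ν ν' h
    have hcont : ∀ ν : FiniteMeasure K,
        Continuous fun f : C(K, ℝ) ↦ ∫ x, f x ∂(ν : Measure K) := by
      intro ν
      refine (LipschitzWith.of_dist_le_mul (K := ν.mass) fun f g ↦ ?_).continuous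
      rw [Real.dist_eq, ← integral_sub (hint ν f) (hint ν g), ← Real.norm_eq_abs]
      refine (norm_integral_le_of_norm_le_const (C := dist f g)
        (Eventually.of_forall fun x ↦ ?_)).trans_eq ?_
      · rw [← dist_eq_norm]
        exact ContinuousMap.dist_apply_le_dist x
      · rw [mul_comm]
        rfl
    have heq := (hcont ν).ext_on (denseRange_denseSeq C(K, ℝ)) (hcont ν') (by
      rintro _ ⟨n, rfl⟩
      exact congrFun (congrArg Prod.snd h) n)
    exact FiniteMeasure.ext_of_forall_integral_eq fun f ↦ congrFun heq f.toContinuousMap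
  -- The mass coordinate is what gives properness: measures of bounded mass on a compact space form
  -- a compact set.
  have hproper : IsProperMap Φ := by
    refine isProperMap_iff_isCompact_preimage.2 ⟨hΦ, fun S hS ↦ ?_⟩
    obtain ⟨C, hC⟩ := (hS.image continuous_fst).bddAbove
    refine (isCompact_setOfPred_finiteMeasure_le_of_compactSpace K C).of_isClosed_subset
      (hS.isClosed.preimage hΦ) fun ν hν ↦ hC ⟨Φ ν, hν, rfl⟩
  exact (IsClosedEmbedding.of_continuous_injective_isClosedMap hΦ hinj
    hproper.isClosedMap).polishSpace

/-- Upper semicontinuity of the mass of a closed set. -/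
theorem eventually_measure_lt_of_tendsto {K γ : Type*} [TopologicalSpace K]
    [MeasurableSpace K] [OpensMeasurableSpace K] [HasOuterApproxClosed K] {L : Filter γ}
    {νs : γ → FiniteMeasure K} {ν : FiniteMeasure K} (h : Tendsto νs L (𝓝 ν)) {F : Set K}
    (hF : IsClosed F) {c : ℝ≥0∞} (hc : (ν : Measure K) F < c) :
    ∀ᶠ i in L, (νs i : Measure K) F < c :=
  eventually_lt_of_limsup_lt ((FiniteMeasure.limsup_measure_closed_le_of_tendsto h hF).trans_lt hc)

/-- If `a + b = m`, convergence of the sums and a lower bound in the limit for the second summand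
give an upper bound in the limit for the first summand. -/
theorem eventually_left_lt_of_add_eq {γ : Type*} {L : Filter γ} {a b m : ℝ≥0∞}
    {as bs ms : γ → ℝ≥0∞} (hab : a + b = m) (hmt : m ≠ ∞) (habs : ∀ i, as i + bs i = ms i)
    (hms : Tendsto ms L (𝓝 m)) (hb : ∀ c < b, ∀ᶠ i in L, c < bs i) (c : ℝ≥0∞) (hc : a < c) :
    ∀ᶠ i in L, as i < c := by
  have hbt : b ≠ ∞ := fun h ↦ hmt (by simp [← hab, h])
  have h1 : m < c + b := by
    rw [← hab]
    exact ENNReal.add_lt_add_right hbt hc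
  obtain ⟨d, hd1, hd2⟩ := exists_between h1
  have hev : ∀ᶠ i in L, d - c ≤ bs i := by
    rcases le_total d c with h | h
    · simp [tsub_eq_zero_of_le h]
    · exact (hb _ (ENNReal.sub_lt_of_lt_add h (by rwa [add_comm]))).mono fun i hi ↦ hi.le
  filter_upwards [hms.eventually_lt_const hd1, hev] with i hi1 hi2
  by_contra! hle
  refine (hi1.trans_le (le_add_tsub.trans (add_le_add hle hi2))).ne (habs i).symm

/-- If `a + b = m`, convergence of the sums and an upper bound in the limit for the second summand
give a lower bound in the limit for the first summand. -/
theorem eventually_lt_left_of_add_eq {γ : Type*} {L : Filter γ} {a b m : ℝ≥0∞}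
    {as bs ms : γ → ℝ≥0∞} (hab : a + b = m) (hmt : m ≠ ∞) (habs : ∀ i, as i + bs i = ms i)
    (hms : Tendsto ms L (𝓝 m)) (hb : ∀ c, b < c → ∀ᶠ i in L, bs i < c) (c : ℝ≥0∞) (hc : c < a) :
    ∀ᶠ i in L, c < as i := by
  have hbt : b ≠ ∞ := fun h ↦ hmt (by simp [← hab, h])
  have h1 : c + b < m := by
    rw [← hab]
    exact ENNReal.add_lt_add_right hbt hc
  obtain ⟨d, hd1, hd2⟩ := exists_between h1
  filter_upwards [hms.eventually_const_lt hd2, hb (d - c) (by rwa [lt_tsub_iff_left])] with i hi1 hi2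
  by_contra! hle
  have : as i + bs i < d := calc
    as i + bs i ≤ c + bs i := by gcongr
    _ < c + (d - c) := ENNReal.add_lt_add_left hc.ne_top hi2
    _ = d := add_tsub_cancel_of_le (le_self_add.trans hd1.le)
  exact (this.trans hi1).ne (habs i)

/-- A portmanteau criterion for finite measures. -/
theorem tendsto_of_forall_isClosed_of_tendsto_mass {E γ : Type*} [TopologicalSpace E]
    [MeasurableSpace E] [BorelSpace E] {L : Filter γ} [L.IsCountablyGenerated]
    {μs : γ → FiniteMeasure E} {μ : FiniteMeasure E}
    (hm : Tendsto (fun i ↦ (μs i).mass) L (𝓝 μ.mass))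
    (hF : ∀ F : Set E, IsClosed F → ∀ c, (μ : Measure E) F < c →
      ∀ᶠ i in L, (μs i : Measure E) F < c) : Tendsto μs L (𝓝 μ) := by
  have hm' : Tendsto (fun i ↦ (μs i : Measure E) univ) L (𝓝 ((μ : Measure E) univ)) := by
    simpa [Function.comp_def] using (ENNReal.continuous_coe.tendsto _).comp hm
  have hG : ∀ G : Set E, IsOpen G → ∀ c < (μ : Measure E) G,
      ∀ᶠ i in L, c < (μs i : Measure E) G := fun G hGo ↦
    eventually_lt_left_of_add_eq (measure_add_measure_compl hGo.measurableSet) (measure_ne_top _ _)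
      (fun i ↦ measure_add_measure_compl hGo.measurableSet) hm' (hF _ hGo.isClosed_compl)
  -- Countable generation of `L` reduces to sequences, for which the liminf bound on integrals is
  -- available.
  refine tendsto_of_seq_tendsto fun u hu ↦ ?_
  have hlow : ∀ f : E →ᵇ ℝ≥0, ∀ c < ∫⁻ x, f x ∂(μ : Measure E),
      ∀ᶠ n in atTop, c < ∫⁻ x, f x ∂(μs (u n) : Measure E) := by
    intro f c hc
    have := lintegral_le_liminf_lintegral_of_forall_isOpen_measure_le_liminf_measure
      (μ := (μ : Measure E)) (μs := fun n ↦ (μs (u n) : Measure E)) (f := fun x ↦ (f x : ℝ))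
      (by fun_prop) (fun x ↦ (f x).2) (fun G hGo ↦ by
        refine le_of_forall_lt fun d hd ↦ ?_
        obtain ⟨e, hde, he⟩ := exists_between hd
        exact hde.trans_le (le_liminf_of_le (by isBoundedDefault)
          ((hu.eventually (hG G hGo e he)).mono fun n hn ↦ hn.le)))
    simp only [ENNReal.ofReal_coe_nnreal] at this
    exact eventually_lt_of_lt_liminf (hc.trans_le this)
  refine FiniteMeasure.tendsto_iff_forall_lintegral_tendsto.2 fun f ↦ ?_
  refine tendsto_order.2 ⟨hlow f, fun c hc ↦ ?_⟩
  -- Lower bounds for the complementary function `‖f‖ - f` become upper bounds for `f`; the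
  -- truncated subtraction is exact since `f ≤ ‖f‖`.
  have hsum : ∀ ν : FiniteMeasure E, ∫⁻ x, f x ∂(ν : Measure E)
      + ∫⁻ x, (BoundedContinuousFunction.const E (nndist f 0) - f) x ∂(ν : Measure E)
      = nndist f 0 * (ν : Measure E) univ := by
    intro ν
    rw [← lintegral_add_left (by fun_prop), ← lintegral_const]
    refine lintegral_congr fun x ↦ ?_
    rw [← ENNReal.coe_add]
    have : f x ≤ nndist f 0 := by
      simpa using f.nndist_coe_le_nndist (g := 0) x
    simp [add_tsub_cancel_of_le this]
  exact eventually_left_lt_of_add_eq (hsum μ) (by finiteness) (fun n ↦ hsum (μs (u n)))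
    (ENNReal.Tendsto.const_mul (hm'.comp hu) (Or.inr ENNReal.coe_ne_top)) (hlow _) c hc

/-- Pushing forward along an embedding onto a measurable set is an embedding of the spaces of
finite measures. -/
theorem isEmbedding_map_finiteMeasure {E K : Type*} [TopologicalSpace E] [MeasurableSpace E]
    [BorelSpace E] [TopologicalSpace K] [MetrizableSpace K] [MeasurableSpace K] [BorelSpace K]
    [MetrizableSpace (FiniteMeasure K)] {f : E → K} (hf : IsEmbedding f)
    (hm : MeasurableSet (range f)) :
    IsEmbedding fun μ : FiniteMeasure E ↦ μ.map f := by
  have hfm : MeasurableEmbedding f := hf.measurableEmbedding hm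
  have hcont := FiniteMeasure.continuous_map hf.continuous
  refine ⟨isInducing_iff_nhds.2 fun μ ↦ le_antisymm (hcont.tendsto μ).le_comap ?_, ?_⟩
  · refine tendsto_of_forall_isClosed_of_tendsto_mass (μs := id)
      (L := comap (fun μ : FiniteMeasure E ↦ μ.map f) (𝓝 (μ.map f))) ?_ fun F hF c hc ↦ ?_
    · have hmass : ∀ ν : FiniteMeasure E, (ν.map f).mass = ν.mass := fun ν ↦ by
        simp [FiniteMeasure.mass, FiniteMeasure.map_apply _ hfm.measurable]
      have := (FiniteMeasure.continuous_mass.tendsto (μ.map f)).comp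
        (tendsto_comap (f := fun μ : FiniteMeasure E ↦ μ.map f))
      simpa only [hmass, Function.comp_def, id] using this
    · obtain ⟨F', hF', rfl⟩ := hf.isClosed_iff.1 hF
      have hc' : (μ.map f : Measure K) F' < c := by
        rwa [FiniteMeasure.toMeasure_map, hfm.map_apply]
      have := eventually_measure_lt_of_tendsto
        (tendsto_comap (f := fun μ : FiniteMeasure E ↦ μ.map f)) hF' hc'
      simpa [hfm.map_apply] using this
  · intro μ ν h
    have h' : (μ : Measure E).map f = (ν : Measure E).map f := congrArg FiniteMeasure.toMeasure h
    apply FiniteMeasure.toMeasure_injective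
    rw [← hfm.comap_map (μ : Measure E), h', hfm.comap_map]

/-- The finite measures carried by a `Gδ` set form a `Gδ` set. -/
theorem isGδ_setOf_measure_compl_eq_zero {K : Type*} [TopologicalSpace K] [MetrizableSpace K]
    [MeasurableSpace K] [BorelSpace K] {G : Set K} (hG : IsGδ G) :
    IsGδ {ν : FiniteMeasure K | (ν : Measure K) Gᶜ = 0} := by
  obtain ⟨V, hVo, rfl⟩ := hG.eq_iInter_nat
  -- Each condition on the right is open, since the mass of the closed set `(V n)ᶜ` is upper
  -- semicontinuous.
  have : {ν : FiniteMeasure K | (ν : Measure K) (⋂ n, V n)ᶜ = 0}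
      = ⋂ n, ⋂ k : ℕ, {ν : FiniteMeasure K | (ν : Measure K) (V n)ᶜ < ((k : ℝ≥0∞) + 1)⁻¹} := by
    ext ν
    simp only [compl_iInter, measure_iUnion_null_iff, mem_ofPred_eq, mem_iInter]
    refine forall_congr' fun n ↦ ⟨fun h k ↦ by simp [h], fun h ↦ ?_⟩
    by_contra hne
    obtain ⟨k, hk⟩ := ENNReal.exists_inv_nat_lt hne
    refine lt_asymm hk ((h k).trans_le ?_)
    gcongr
    exact le_self_add
  rw [this]
  refine IsGδ.iInter fun n ↦ IsGδ.iInter_of_isOpen fun k ↦ isOpen_iff_mem_nhds.2 fun ν hν ↦ ?_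
  exact eventually_measure_lt_of_tendsto tendsto_id (hVo n).isClosed_compl hν

/-- The finite Borel measures on a Polish space, with the weak topology, form a Polish space. -/
theorem polishSpace_finiteMeasure (E : Type*) [TopologicalSpace E] [PolishSpace E]
    [MeasurableSpace E] [BorelSpace E] : PolishSpace (FiniteMeasure E) := by
  obtain ⟨f, hf⟩ : ∃ f : E → ℕ → unitInterval, IsEmbedding f := by
    let := upgradeIsCompletelyMetrizable E
    exact Metric.PiNatEmbed.exists_embedding_to_hilbert_cube
  have hG := isGδ_range_of_isEmbedding hf
  have := polishSpace_finiteMeasure_of_compactSpace (ℕ → unitInterval)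
  have hfm : MeasurableEmbedding f := hf.measurableEmbedding hG.measurableSet
  refine polishSpace_of_isEmbedding_of_isGδ (isEmbedding_map_finiteMeasure hf hG.measurableSet) ?_
  convert isGδ_setOf_measure_compl_eq_zero hG using 1
  ext ν
  constructor
  · rintro ⟨μ, rfl⟩
    simp [hfm.map_apply]
  · intro hν
    refine ⟨ν.comap f, FiniteMeasure.toMeasure_injective ?_⟩
    rw [FiniteMeasure.toMeasure_map, FiniteMeasure.toMeasure_comap, hfm.map_comap]
    exact Measure.restrict_eq_self_of_ae_mem hν

/-! ### The vague topology, exhaustions and densities. -/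

variable {E : Type*} [TopologicalSpace E] [MeasurableSpace E]

theorem BoundedlyFiniteMeasure.toMeasure_injective {Ω : Type*} [MeasurableSpace Ω]
    {Bb : Set (Set Ω)} :
    Function.Injective (BoundedlyFiniteMeasure.toMeasure : BoundedlyFiniteMeasure Bb → Measure Ω) :=
  fun ⟨_, _⟩ ⟨_, _⟩ h ↦ by cases h; rfl

theorem tendsto_vague_iff {γ : Type*} {Bb : Set (Set E)} {L : Filter γ}
    {μs : γ → BoundedlyFiniteMeasure Bb} {μ : BoundedlyFiniteMeasure Bb} :
    Tendsto μs L (𝓝 μ) ↔ ∀ f ∈ CBbPlus Bb,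
      Tendsto (fun i ↦ ∫ x, f x ∂(μs i).toMeasure) L (𝓝 (∫ x, f x ∂μ.toMeasure)) := by
  simp only [nhds_iInf, nhds_induced, tendsto_iInf, tendsto_comap_iff,
    Function.comp_def]

/-- An exhaustion of a space by bounded open sets, together with Urysohn functions. -/
structure Exhaustion {Ω : Type*} [TopologicalSpace Ω] (Bb : Set (Set Ω)) where
  /-- the bounded open sets -/
  U : ℕ → Set Ω
  /-- the Urysohn functions -/
  φ : ℕ → Ω →ᵇ ℝ≥0
  isOpen_U : ∀ n, IsOpen (U n)
  U_mem : ∀ n, U n ∈ Bb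
  closure_subset : ∀ n, closure (U n) ⊆ U (n + 1)
  exists_subset : ∀ B ∈ Bb, ∃ n, B ⊆ U n
  iUnion_U : ⋃ n, U n = univ
  φ_eq_one : ∀ n, ∀ x ∈ closure (U n), φ n x = 1
  φ_eq_zero : ∀ n, ∀ x ∉ U (n + 1), φ n x = 0

theorem ProperlyLocalizes.nonempty_exhaustion [NormalSpace E] [Nonempty E]
    {Bb : Set (Set E)} (h : ProperlyLocalizes Bb) : Nonempty (Exhaustion Bb) := by
  obtain ⟨Cb, hCc, ⟨hCB, hcof⟩, hcov⟩ := h.exists_countable_basis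
  have hCne : Cb.Nonempty := by
    by_contra hne
    rw [not_nonempty_iff_eq_empty] at hne
    rw [hne, sUnion_empty] at hcov
    exact empty_ne_univ hcov
  obtain ⟨C, rfl⟩ := hCc.exists_eq_range hCne
  have hC : ∀ n, C n ∈ Bb := fun n ↦ hCB (mem_range_self n)
  choose V hVB hVo hV using h.isProper
  -- Each set is an open bounded enlargement of the closure of the previous one together with the
  -- next basis set, so the sequence is cofinal in `Bb`.
  let U : ℕ → {W // W ∈ Bb} := Nat.rec ⟨V (C 0) (hC 0), hVB _ _⟩ fun n W ↦
    ⟨V (W.1 ∪ C (n + 1)) (h.isBoundedness.union_mem _ _ W.2 (hC _)), hVB _ _⟩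
  have hUo : ∀ n, IsOpen (U n).1
    | 0 => hVo _ _
    | n + 1 => hVo _ _
  have hCU : ∀ n, C n ⊆ (U n).1
    | 0 => subset_closure.trans (hV _ _)
    | n + 1 => (subset_union_right.trans subset_closure).trans (hV _ _)
  have hcl : ∀ n, closure (U n).1 ⊆ (U (n + 1)).1 := fun n ↦
    (closure_mono subset_union_left).trans (hV _ _)
  have hφ : ∀ n, ∃ φ : E →ᵇ ℝ≥0,
      (∀ x ∈ closure (U n).1, φ x = 1) ∧ ∀ x ∉ (U (n + 1)).1, φ x = 0 := by
    intro n
    obtain ⟨g, h0, h1, hg⟩ := exists_continuous_zero_one_of_isClosed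
      (hUo (n + 1)).isClosed_compl isClosed_closure
      (disjoint_compl_left_iff_subset.2 (hcl n))
    refine ⟨BoundedContinuousFunction.mkOfBound ⟨fun x ↦ (g x).toNNReal, by fun_prop⟩ 1
      fun x y ↦ ?_, fun x hx ↦ ?_, fun x hx ↦ ?_⟩
    · rw [NNReal.dist_eq]
      simpa [← Real.dist_eq, (hg x).1, (hg y).1] using Real.dist_le_of_mem_Icc_01 (hg x) (hg y)
    · simp [h1 hx]
    · simp [h0 hx]
  choose φ hφ1 hφ0 using hφ
  refine ⟨⟨fun n ↦ (U n).1, φ, hUo, fun n ↦ (U n).2, hcl, fun B hB ↦ ?_, ?_, hφ1, hφ0⟩⟩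
  · obtain ⟨_, ⟨n, rfl⟩, hn⟩ := hcof B hB
    exact ⟨n, hn.trans (hCU n)⟩
  · rw [← univ_subset_iff, ← hcov, sUnion_range]
    exact iUnion_mono hCU

/-- The finite measure with a bounded continuous density with respect to a finite measure. -/
noncomputable def weight [OpensMeasurableSpace E] (φ : E →ᵇ ℝ≥0) (ν : FiniteMeasure E) :
    FiniteMeasure E :=
  ⟨(ν : Measure E).withDensity fun x ↦ φ x,
    isFiniteMeasure_withDensity (φ.lintegral_lt_top_of_nnreal _).ne⟩

theorem continuous_weight [OpensMeasurableSpace E] (φ : E →ᵇ ℝ≥0) : Continuous (weight φ) := by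
  refine FiniteMeasure.continuous_iff_forall_continuous_lintegral.2 fun f ↦ ?_
  have : ∀ ν : FiniteMeasure E, ∫⁻ x, f x ∂(weight φ ν : Measure E)
      = ∫⁻ x, (φ * f) x ∂(ν : Measure E) := fun ν ↦ by
    simp only [weight, FiniteMeasure.toMeasure_mk]
    rw [lintegral_withDensity_eq_lintegral_mul _ (by fun_prop) (by fun_prop)]
    simp
  simp only [this]
  fun_prop

/-! ### The embedding by cutoffs and its closed range. -/

namespace Exhaustion

theorem monotone_U {Ω : Type*} [TopologicalSpace Ω] {Bb : Set (Set Ω)} (e : Exhaustion Bb) :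
    Monotone e.U :=
  monotone_nat_of_le_succ fun n ↦ subset_closure.trans (e.closure_subset n)

/-- Where `φ m` does not vanish, the point lies in `U (m + 1) ⊆ U n`, on which `φ n = 1`; this needs
`m < n` strictly. -/
theorem φ_mul_of_lt {Ω : Type*} [TopologicalSpace Ω] {Bb : Set (Set Ω)} (e : Exhaustion Bb)
    {m n : ℕ} (h : m < n) (x : Ω) : e.φ n x * e.φ m x = e.φ m x := by
  by_cases hx : x ∈ e.U (m + 1)
  · rw [e.φ_eq_one n x (subset_closure (e.monotone_U h hx)), one_mul]
  · rw [e.φ_eq_zero m x hx, mul_zero]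

variable {Bb : Set (Set E)} (e : Exhaustion Bb)

theorem lintegral_φ_lt_top (μ : BoundedlyFiniteMeasure Bb) (n : ℕ) :
    ∫⁻ x, e.φ n x ∂μ.toMeasure < ∞ := by
  have : Fact (μ.toMeasure (e.U (n + 1)) < ∞) := ⟨μ.finite_of_mem _ (e.U_mem _)⟩
  rw [← setLIntegral_eq_of_support_subset (s := e.U (n + 1))]
  · exact (e.φ n).lintegral_lt_top_of_nnreal _
  · intro x hx
    by_contra hxU
    simp [e.φ_eq_zero n x hxU] at hx

/-- The finite measures obtained by cutting off a boundedly finite measure. -/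
noncomputable def cutoff (μ : BoundedlyFiniteMeasure Bb) (n : ℕ) : FiniteMeasure E :=
  ⟨μ.toMeasure.withDensity fun x ↦ e.φ n x,
    isFiniteMeasure_withDensity (e.lintegral_φ_lt_top μ n).ne⟩

theorem toMeasure_cutoff (μ : BoundedlyFiniteMeasure Bb) (n : ℕ) :
    (e.cutoff μ n : Measure E) = μ.toMeasure.withDensity fun x ↦ e.φ n x := rfl

variable [BorelSpace E]

theorem measurableSet_U (n : ℕ) : MeasurableSet (e.U n) := (e.isOpen_U n).measurableSet

theorem restrict_withDensity_φ (μ : Measure E) {m n : ℕ} (h : m ≤ n) :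
    (μ.withDensity fun x ↦ e.φ n x).restrict (e.U m) = μ.restrict (e.U m) := by
  rw [restrict_withDensity (e.measurableSet_U m)]
  conv_rhs => rw [← withDensity_one (μ := μ.restrict (e.U m))]
  refine withDensity_congr_ae ?_
  filter_upwards [ae_restrict_mem (e.measurableSet_U m)] with x hx
  simp [e.φ_eq_one n x (subset_closure (e.monotone_U h hx))]

/-- The `n`-th cutoff determines the measure on `U n`, and these sets cover the space. -/
theorem cutoff_injective : Function.Injective e.cutoff := by
  intro μ ν h
  refine BoundedlyFiniteMeasure.toMeasure_injective
    ((Measure.ext_iff_of_iUnion_eq_univ e.iUnion_U).2 fun n ↦ ?_)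
  rw [← e.restrict_withDensity_φ μ.toMeasure le_rfl,
    ← e.restrict_withDensity_φ ν.toMeasure le_rfl, ← toMeasure_cutoff, ← toMeasure_cutoff, h]

theorem continuous_cutoff (hBb : IsBoundedness Bb) : Continuous e.cutoff := by
  refine continuous_pi fun n ↦ continuous_iff_continuousAt.2 fun μ ↦ ?_
  refine FiniteMeasure.tendsto_iff_forall_lintegral_tendsto.2 fun f ↦ ?_
  let g : E →ᵇ ℝ := (e.φ n * f).comp _ (LipschitzWith.subtype_val _)
  have hg : g ∈ CBbPlus Bb := by
    refine ⟨fun x ↦ ((e.φ n * f) x).2, hBb.subset_mem _ _ (isClosed_tsupport _).measurableSet ?_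
      -- `φ n` vanishes off `U (n + 1)`, but the support is a closure, hence the second shift.
      (e.U_mem (n + 2))⟩
    refine (closure_mono fun x hx ↦ ?_).trans (e.closure_subset (n + 1))
    by_contra hxU
    refine hx ?_
    change (((e.φ n * f) x : ℝ≥0) : ℝ) = 0
    simp [e.φ_eq_zero n x hxU]
  have key : ∀ ν : BoundedlyFiniteMeasure Bb, ∫⁻ x, f x ∂(e.cutoff ν n : Measure E)
      = ENNReal.ofReal (∫ x, g x ∂ν.toMeasure) := by
    intro ν
    rw [ofReal_integral_eq_lintegral_ofReal (integrable_of_mem_CBbPlus ν hg)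
      (Eventually.of_forall hg.1), toMeasure_cutoff,
      lintegral_withDensity_eq_lintegral_mul _ (by fun_prop) (by fun_prop)]
    refine lintegral_congr fun x ↦ ?_
    change _ = ENNReal.ofReal (((e.φ n * f) x : ℝ≥0) : ℝ)
    simp
  simp only [key]
  exact (ENNReal.continuous_ofReal.tendsto _).comp (tendsto_vague_iff.1 tendsto_id g hg)

theorem isEmbedding_cutoff (hBb : IsBoundedness Bb) : IsEmbedding e.cutoff := by
  refine ⟨isInducing_iff_nhds.2 fun μ ↦
    le_antisymm ((e.continuous_cutoff hBb).tendsto μ).le_comap ?_, e.cutoff_injective⟩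
  refine (tendsto_vague_iff (μs := id) (L := comap e.cutoff (𝓝 (e.cutoff μ)))).2 fun f hf ↦ ?_
  obtain ⟨n, hn⟩ := e.exists_subset _ hf.2
  have key : ∀ ν : BoundedlyFiniteMeasure Bb, ∫ x, f x ∂ν.toMeasure
      = ∫ x, f x ∂(e.cutoff ν n : Measure E) := by
    intro ν
    rw [toMeasure_cutoff, integral_withDensity_eq_integral_smul
      (e.φ n).continuous.measurable]
    refine integral_congr_ae (Eventually.of_forall fun x ↦ ?_)
    by_cases hx : x ∈ tsupport f
    · simp [e.φ_eq_one n x (subset_closure (hn hx))]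
    · simp [image_eq_zero_of_notMem_tsupport hx]
  simp only [key, id]
  have hn' : Tendsto (fun ν ↦ e.cutoff ν n) (comap e.cutoff (𝓝 (e.cutoff μ)))
      (𝓝 (e.cutoff μ n)) := (tendsto_pi_nhds.1 tendsto_comap) n
  exact FiniteMeasure.tendsto_iff_forall_integral_tendsto.1 hn' f

theorem withDensity_φ_mul (μ : Measure E) {m n : ℕ} (h : m < n) :
    (μ.withDensity fun x ↦ e.φ n x).withDensity (fun x ↦ (e.φ m x : ℝ≥0∞))
      = μ.withDensity fun x ↦ e.φ m x := by
  rw [← withDensity_mul _ (by fun_prop) (by fun_prop)]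
  congr 1
  ext x
  simp [← ENNReal.coe_mul, e.φ_mul_of_lt h]

/-- The sequences of finite measures that come from one boundedly finite measure. -/
theorem range_cutoff : range e.cutoff = {ν | ∀ n, weight (e.φ n) (ν (n + 1)) = ν n} := by
  apply Subset.antisymm
  · rintro _ ⟨μ, rfl⟩ n
    exact FiniteMeasure.toMeasure_injective (e.withDensity_φ_mul _ n.lt_succ_self)
  · intro ν hν
    have hν1 : ∀ n, (ν (n + 1) : Measure E).withDensity (fun x ↦ e.φ n x) = ν n := fun n ↦
      congrArg FiniteMeasure.toMeasure (hν n)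
    have hlt : ∀ {m n}, m < n →
        (ν n : Measure E).withDensity (fun x ↦ e.φ m x) = ν m := by
      intro m n h
      induction n, h using Nat.le_induction with
      | base => exact hν1 m
      | succ n hmn ih =>
        rw [← e.withDensity_φ_mul _ (Nat.lt_of_succ_le hmn), hν1, ih]
    have hrestr : ∀ {m n}, m ≤ n →
        (ν n : Measure E).restrict (e.U m) = (ν m : Measure E).restrict (e.U m) := by
      intro m n h
      rcases h.eq_or_lt with rfl | h
      · rfl
      · rw [← hlt h, e.restrict_withDensity_φ _ le_rfl]
    -- On `U n`, the measure `ν n` can replace the limit measure: its cutoff by `φ k` is already `ν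
    -- k` there, for `k` on either side of `n`.
    have hloc : ∀ k n, ((ν n : Measure E).withDensity fun x ↦ e.φ k x).restrict (e.U n)
        = (ν k : Measure E).restrict (e.U n) := by
      intro k n
      rcases lt_or_ge k n with h | h
      · rw [hlt h]
      · rw [e.restrict_withDensity_φ _ h, hrestr h]
    -- Glue along the disjoint pieces `U n \ (U 0 ∪ … ∪ U (n - 1))`, using `ν n` on the `n`-th
    -- piece.
    let D := disjointed e.U
    have hDm : ∀ n, MeasurableSet (D n) := MeasurableSet.disjointed e.measurableSet_U
    let μ : Measure E := Measure.sum fun n ↦ (ν n : Measure E).restrict (D n)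
    have hμ : ∀ k, μ.withDensity (fun x ↦ e.φ k x) = ν k := by
      intro k
      have h1 : ∀ n, ((ν n : Measure E).restrict (D n)).withDensity (fun x ↦ (e.φ k x : ℝ≥0∞))
          = (ν k : Measure E).restrict (D n) := by
        intro n
        have := congrArg (fun ρ ↦ ρ.restrict (D n)) (hloc k n)
        rw [← restrict_withDensity (hDm n)]
        simpa only [Measure.restrict_restrict_of_subset (show D n ⊆ e.U n from
          disjointed_subset e.U n)] using this
      rw [withDensity_sum]
      simp only [h1]
      rw [← Measure.restrict_iUnion (disjoint_disjointed e.U) hDm, iUnion_disjointed, e.iUnion_U,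
        Measure.restrict_univ]
    refine ⟨⟨μ, fun B hB ↦ ?_⟩, funext fun n ↦ FiniteMeasure.toMeasure_injective (hμ n)⟩
    obtain ⟨n, hn⟩ := e.exists_subset B hB
    calc μ B ≤ μ (e.U n) := measure_mono hn
      _ = (μ.withDensity fun x ↦ e.φ n x) (e.U n) := by
        rw [← Measure.restrict_apply_self, ← e.restrict_withDensity_φ μ le_rfl,
          Measure.restrict_apply_self]
      _ < ∞ := by
        rw [hμ n]
        exact measure_lt_top _ _

theorem isClosedEmbedding_cutoff [HasOuterApproxClosed E] (hBb : IsBoundedness Bb) :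
    IsClosedEmbedding e.cutoff := by
  refine ⟨e.isEmbedding_cutoff hBb, ?_⟩
  rw [range_cutoff, ofPred_forall]
  exact isClosed_iInter fun n ↦ isClosed_eq
    ((continuous_weight _).comp (continuous_apply _)) (continuous_apply _)

end Exhaustion

end VagueTopology

theorem proposition3p1 {X : Type*} [TopologicalSpace X] [PolishSpace X]
    [MeasurableSpace X] [BorelSpace X] (Bb : Set (Set X))
    (hBb : VagueTopology.ProperlyLocalizes Bb) :
    TopologicalSpace.MetrizableSpace (VagueTopology.BoundedlyFiniteMeasure Bb) ∧
      PolishSpace (VagueTopology.BoundedlyFiniteMeasure Bb) := by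
  suffices h : PolishSpace (VagueTopology.BoundedlyFiniteMeasure Bb) from ⟨inferInstance, h⟩
  -- On the empty space the countable basis may be empty and cannot be enumerated as a sequence.
  cases isEmpty_or_nonempty X
  · have : Subsingleton (VagueTopology.BoundedlyFiniteMeasure Bb) :=
      VagueTopology.BoundedlyFiniteMeasure.toMeasure_injective.subsingleton
    infer_instance
  · obtain ⟨e⟩ := hBb.nonempty_exhaustion
    have := VagueTopology.polishSpace_finiteMeasure X
    exact (e.isClosedEmbedding_cutoff hBb.isBoundedness).polishSpace
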